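/- Let $\mathbf T$ be a (nonempty) countable homogeneous tournament, and let $\mathbf T^*$ be its standard expansion. The possible $\mathbf T$, up to isomorphism, and the relations that $\mathbf T^*$ adds to the edge relation $E$ (a linear order $<^*$ and finitely many unary predicates) are: * $I_1$ (one point): $<^*$ is the empty relation, and one unary predicate names the point; * $C_3$ (the directed 3-cycle): $<^*$ is any linear order, and three unary predicates name the three points; * $\mathbb Q$, with $E(x,y)\iff x<y$: $<^*$ is the usual order, and there are no unary predicates; * $\mathbf S(2)$, the set of points $e^{i\theta}$, $\theta\in\mathbb Q$, of the unit circle, with $E(x,y)$ iff the angle from $x$ to $y$ lies in $(0,\pi)$: two unary predicates name the left half ($\cos\theta<0$) and the right half ($\cos\theta>0$), and $<^*$ is the linear order obtained from $E$ by reversing the edges between points in different halves; * $T^\omega$, the generic tournament: $(T^\omega)^*$ is the Fraïssé limit of the class of all finite linearly ordered tournaments, with no unary predicates. Let $n$ be a natural number, and let $I_n[\mathbf T]^*$ be the structure with universe $\{0,\dots,n-1\}\times T$ in which: * $E((i,x),(j,y))$ holds iff $i=j$ and $E(x,y)$ holds in $\mathbf T^*$; * each unary predicate $R$ of $\mathbf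 T^*$ holds at $(i,x)$ iff $R(x)$ holds in $\mathbf T^*$; * $(i,x)<(j,y)$ iff $i<j$, or $i=j$ and $x<^*y$; * for each $i<n$, a new unary predicate $P_i$ holds exactly at the points $(i,x)$, $x\in T$. Let $\mathcal K=\mathrm{Age}(I_n[\mathbf T]^*)$ be the class of all finite structures that embed in $I_n[\mathbf T]^*$. Then $\mathcal K$ has the Ramsey property: for every $r\in\mathbb N$ and all $\mathbf A,\mathbf B\in\mathcal K$ there is $\mathbf C\in\mathcal K$ such that for every colouring with $r$ colours of the substructures of $\mathbf C$ isomorphic to $\mathbf A$, there is a substructure $\mathbf B'$ of $\mathbf C$ isomorphic to $\mathbf B$ such that all substructures of $\mathbf B'$ isomorphic to $\mathbf A$ have the same colour. -/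

import Mathlib

open FirstOrder FirstOrder.Language CategoryTheory

universe u

/-! ### The Ramsey property -/

/-- The set of copies of `A` in `C`: the substructures of `C` that are isomorphic to `A`. -/
def Copies (L : FirstOrder.Language.{0, 0}) (C A : Type u) [L.Structure C] [L.Structure A] :
    Set (L.Substructure C) :=
  {S | Nonempty (S ≃[L] A)}

/-- The arrow `C ⟶ (B)^A_r`: for every colouring of the copies of `A` in `C` with `r` colours
there is a copy of `B` in `C` such that all copies of `A` inside it have the same colour. -/
def Arrows (L : FirstOrder.Language.{0, 0}) (C B A : Type u)
    [L.Structure C] [L.Structure B] [L.Structure A] (r : ℕ) : Prop :=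
  ∀ c : Copies L C A → Fin r, ∃ B' ∈ Copies L C B,
    ∀ A₁ A₂ : Copies L C A, A₁.1 ≤ B' → A₂.1 ≤ B' → c A₁ = c A₂

/-- The Ramsey property of a class of structures. -/
def HasRamseyProperty (L : FirstOrder.Language.{0, 0}) (K : Set (Bundled.{u} L.Structure)) : Prop :=
  ∀ r : ℕ, ∀ A ∈ K, ∀ B ∈ K, ∃ C ∈ K, Arrows L C B A r

/-! ### Languages -/

/-- The relation symbol of directed graphs. -/
inductive DigraphRel : ℕ → Type
  | edge : DigraphRel 2

/-- The language of directed graphs: one binary relation symbol. -/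
def digraphLang : FirstOrder.Language.{0, 0} := ⟨fun _ => Empty, DigraphRel⟩

/-- The relation symbols of expanded directed graphs: the edge relation, a distinguished binary
symbol for a linear order, and unary predicates indexed by `κ`. -/
inductive StarRel (κ : Type) : ℕ → Type
  | edge : StarRel κ 2
  | lt : StarRel κ 2
  | pred (i : κ) : StarRel κ 1

/-- The language with an edge symbol, an order symbol and unary predicates indexed by `κ`. -/
def starLang (κ : Type) : FirstOrder.Language.{0, 0} := ⟨fun _ => Empty, StarRel κ⟩

instance : digraphLang.IsRelational := fun _ => (inferInstance : IsEmpty Empty)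

instance (κ : Type) : (starLang κ).IsRelational := fun _ => (inferInstance : IsEmpty Empty)

/-- The inclusion of the language of directed graphs into the expanded language. -/
def digraphToStar (κ : Type) : digraphLang →ᴸ starLang κ where
  onFunction := fun _ f => Empty.elim f
  onRelation := fun _ R => match R with
    | DigraphRel.edge => StarRel.edge

/-- The edge relation of a directed graph. -/
def Edge {T : Type u} [digraphLang.Structure T] (x y : T) : Prop :=
  Structure.RelMap (L := digraphLang) DigraphRel.edge ![x, y]

/-- The edge relation of a structure in the expanded language. -/
def SEdge (κ : Type) {T : Type u} [(starLang κ).Structure T] (x y : T) : Prop :=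
  Structure.RelMap (L := starLang κ) (StarRel.edge : StarRel κ 2) ![x, y]

/-- The distinguished order relation of a structure in the expanded language. -/
def SLt (κ : Type) {T : Type u} [(starLang κ).Structure T] (x y : T) : Prop :=
  Structure.RelMap (L := starLang κ) (StarRel.lt : StarRel κ 2) ![x, y]

/-- The unary predicate with index `i` of a structure in the expanded language. -/
def SPred {κ : Type} (i : κ) {T : Type u} [(starLang κ).Structure T] (x : T) : Prop :=
  Structure.RelMap (L := starLang κ) (StarRel.pred i : StarRel κ 1) ![x]

/-- `E` is a tournament: it is irreflexive, and every pair of distinct points carries exactly one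
directed edge. -/
def IsTournamentRel {T : Type u} (E : T → T → Prop) : Prop :=
  (∀ x, ¬ E x x) ∧ ∀ x y, x ≠ y → Xor (E x y) (E y x)

/-! ### The homogeneous tournaments and their standard expansions -/

/-- The five isomorphism types of (nonempty) countable homogeneous tournaments: the one-point
tournament `I₁`, the 3-cycle `C₃`, the rationals, the dense local order `S(2)` and the generic
tournament `T^ω`. -/
inductive TournamentKind
  | point
  | cycle
  | rationals
  | denseLocalOrder
  | generic

/-- The number of unary predicates that are added in the standard expansion. -/
def TournamentKind.numPred : TournamentKind → ℕ
  | .point => 1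
  | .cycle => 3
  | .rationals => 0
  | .denseLocalOrder => 2
  | .generic => 0

/-- `I₁*`: one point, named by a unary predicate; edge relation and order are empty. -/
def IsPointStar (T : Type u) [(starLang (Fin 1)).Structure T] : Prop :=
  Nonempty (T ≃ Unit) ∧ (∀ x y : T, ¬ SEdge (Fin 1) x y) ∧
    (∀ x y : T, ¬ SLt (Fin 1) x y) ∧ ∀ x : T, SPred (0 : Fin 1) x

/-- `C₃*`: the directed 3-cycle, each of whose points is named by a unary predicate, together with
a linear order. -/
def IsCycleStar (T : Type u) [(starLang (Fin 3)).Structure T] : Prop :=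
  (∃ e : T ≃ ZMod 3, ∀ x y : T, SEdge (Fin 3) x y ↔ e y = e x + 1) ∧
    (∃ f : T ≃ Fin 3, ∀ (i : Fin 3) (x : T), SPred i x ↔ f x = i) ∧
    IsStrictTotalOrder T (SLt (Fin 3))

/-- `ℚ*`: the rationals, where both the edge relation and the order are the usual order. -/
def IsRationalsStar (T : Type u) [(starLang (Fin 0)).Structure T] : Prop :=
  ∃ e : T ≃ ℚ, ∀ x y : T,
    (SEdge (Fin 0) x y ↔ e x < e y) ∧ (SLt (Fin 0) x y ↔ e x < e y)

/-- The points of the unit circle at a rational angle (in radians). -/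
def RationalAngle : Type := {θ : Real.Angle // ∃ q : ℚ, θ = ((q : ℝ) : Real.Angle)}

/-- The edge relation of the dense local order `S(2)`: the angle from `x` to `y` is in
`(0, π)`. -/
def RationalAngle.Edge (x y : RationalAngle) : Prop :=
  (y.1 - x.1).toReal ∈ Set.Ioo 0 Real.pi

/-- `S(2)*`: the dense local order with two unary predicates for the left and the right half of the
circle, and the linear order that is obtained from the edge relation by reversing the edges between
points of different halves. -/
def IsDenseLocalOrderStar (T : Type u) [(starLang (Fin 2)).Structure T] : Prop :=
  (∃ e : T ≃ RationalAngle,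
    (∀ x y : T, SEdge (Fin 2) x y ↔ (e x).Edge (e y)) ∧
    (∀ x : T, SPred (0 : Fin 2) x ↔ (e x).1.cos < 0) ∧
    (∀ x : T, SPred (1 : Fin 2) x ↔ 0 < (e x).1.cos)) ∧
  ∀ x y : T, SLt (Fin 2) x y ↔
    ((SPred (0 : Fin 2) x ↔ SPred (0 : Fin 2) y) ∧ SEdge (Fin 2) x y) ∨
    (¬ (SPred (0 : Fin 2) x ↔ SPred (0 : Fin 2) y) ∧ SEdge (Fin 2) y x)

/-- The class of all finite tournaments equipped with an arbitrary linear order. -/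
def finiteOrderedTournaments : Set (Bundled.{u} (starLang (Fin 0)).Structure) :=
  {M | Finite M ∧ IsTournamentRel (T := M) (SEdge (Fin 0)) ∧ IsStrictTotalOrder M (SLt (Fin 0))}

/-- `T^ω*`: the generic tournament with a generic linear order, that is, the Fraïssé limit of the
finite linearly ordered tournaments. -/
def IsGenericStar (T : Type u) [Countable T] [(starLang (Fin 0)).Structure T] : Prop :=
  IsFraisseLimit finiteOrderedTournaments.{u} T

/-- The structure on `T` is (isomorphic to) the standard expansion `T*` of the homogeneous
tournament of kind `k`. -/
def IsStandardExpansion : (k : TournamentKind) → (T : Type u) → [Countable T] →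
    [(starLang (Fin k.numPred)).Structure T] → Prop
  | .point, T, _, S => @IsPointStar T S
  | .cycle, T, _, S => @IsCycleStar T S
  | .rationals, T, _, S => @IsRationalsStar T S
  | .denseLocalOrder, T, _, S => @IsDenseLocalOrderStar T S
  | .generic, T, hT, S => @IsGenericStar T hT S

/-! ### The structure `I_n[T]*` -/

/-- The universe of `I_n[T]`: all pairs `(i, x)` with `i ∈ {0, …, n - 1}` and `x ∈ T`. -/
def CopiesOf (n : ℕ) (T : Type u) : Type u := Fin n × T

/-- The structure `I_n[T*]`: edges and the predicates of `T*` are inherited inside each part, the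
order is lexicographic, and the new unary predicate with index `i` names the `i`-th part. -/
instance CopiesOf.structure (n : ℕ) (κ : Type) (T : Type u) [(starLang κ).Structure T] :
    (starLang (κ ⊕ Fin n)).Structure (CopiesOf n T) where
  funMap := fun f _ => Empty.elim f
  RelMap := fun R => match R with
    | StarRel.edge => fun v => (v 0).1 = (v 1).1 ∧ SEdge κ (v 0).2 (v 1).2
    | StarRel.lt => fun v =>
        (v 0).1 < (v 1).1 ∨ ((v 0).1 = (v 1).1 ∧ SLt κ (v 0).2 (v 1).2)
    | StarRel.pred (Sum.inl p) => fun v => SPred p (v 0).2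
    | StarRel.pred (Sum.inr i) => fun v => (v 0).1 = i

/-! If `T` has one or three points, the predicates name every point of `I_n[T]*`. There is then at
most one embedding between two members of the age, and the Ramsey property is trivial.

The infinite cases rest on one combinatorial fact, `exists_ramsey_labelled`: finite linear orders
whose pairs carry arbitrary labels form a Ramsey class. It is proved by a partite construction.
Ramsey's theorem handles the projection to a chain, and the Hales–Jewett theorem
(`exists_homogeneous_over`) homogenises the labelled maps over one projection at a time.

To transfer this to the age of a structure `M`, edges and predicates become labels. The labelled
order `V` so obtained may carry labels that never occur in `M`, but inside a copy of `B` every label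
occurs there, since `B` embeds in `M`. Hence a map `V → M` that is correct wherever the labels make
sense in `M` suffices, and its image generates the required `C`
(`hasRamseyProperty_age_of_realizes`).

In `I_n[T]*` the predicates `P_i` decide everything between different parts, so only
`RealizesOrders` for `T*` remains. For `ℚ` and `S(2)` the order and the predicates determine the
edges, and every finite order with predicates occurs; for `T^ω` the edges are independent of the
order, and every finite ordered tournament embeds. -/

/-! ### Ramsey's theorem -/

/-- A colouring of the `(a + 1)`-subsets of a large finite set depends only on the minimum of the
subset, after passing to a subset of prescribed size. -/
theorem exists_subset_color_eq_min {r a : ℕ}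
    (ih : ∀ m, ∃ N, ∀ S : Finset ℕ, N ≤ S.card → ∀ c : Finset ℕ → Fin r,
      ∃ H ⊆ S, m ≤ H.card ∧ ∃ k, ∀ F ⊆ H, F.card = a → c F = k) (m : ℕ) :
    ∃ N, ∀ S : Finset ℕ, N ≤ S.card → ∀ c : Finset ℕ → Fin r,
      ∃ H ⊆ S, m ≤ H.card ∧ ∃ d : ℕ → Fin r, ∀ x ∈ H, ∀ F ⊆ H, (∀ y ∈ F, x < y) →
        F.card = a → c (insert x F) = d x := by
  induction m with
  | zero => exact ⟨0, fun S _ c => ⟨∅, by simp, by simp, fun _ => c ∅, by simp⟩⟩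
  | succ m ihm =>
    obtain ⟨N₁, hN₁⟩ := ihm
    obtain ⟨N₂, hN₂⟩ := ih N₁
    refine ⟨N₂ + 1, fun S hS c => ?_⟩
    have hne : S.Nonempty := Finset.card_pos.1 (by omega)
    set x := S.min' hne with hx
    have hxS : x ∈ S := S.min'_mem hne
    -- Fix the colour of all sets with minimum `x` first, keeping enough points (`N₁`) to treat the
    -- later minima inside `H₂`.
    obtain ⟨H₂, hH₂, hc₂, k, hk⟩ := hN₂ (S.erase x)
      (by rw [Finset.card_erase_of_mem hxS]; omega) (fun F => c (insert x F))
    obtain ⟨H₁, hH₁, hc₁, d, hd⟩ := hN₁ H₂ hc₂ c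
    have hlt : ∀ y ∈ H₁, x < y := fun y hy => by
      have := hH₂ (hH₁ hy)
      rw [Finset.mem_erase] at this
      exact lt_of_le_of_ne (S.min'_le y this.2) (Ne.symm this.1)
    have hxH : x ∉ H₁ := fun h => lt_irrefl _ (hlt x h)
    refine ⟨insert x H₁, ?_, ?_, Function.update d x k, ?_⟩
    · refine Finset.insert_subset hxS (hH₁.trans (hH₂.trans (Finset.erase_subset _ _)))
    · rw [Finset.card_insert_of_notMem hxH]; omega
    · intro y hy F hF hyF hFa
      have hFx : F ⊆ H₁ := fun z hz => by
        rcases Finset.mem_insert.1 (hF hz) with h | h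
        · exfalso
          have h1 := hyF z hz
          rcases Finset.mem_insert.1 hy with h' | h'
          · omega
          · have := hlt y h'; omega
        · exact h
      rcases Finset.mem_insert.1 hy with rfl | hy
      · rw [Function.update_self]
        exact hk F (hFx.trans hH₁) hFa
      · rw [Function.update_of_ne (hlt y hy).ne']
        exact hd y hy F hFx hyF hFa

/-- The finite **Ramsey theorem** for colourings of `a`-subsets. -/
theorem exists_homogeneous_subset (r : ℕ) [NeZero r] (a m : ℕ) :
    ∃ N, ∀ S : Finset ℕ, N ≤ S.card → ∀ c : Finset ℕ → Fin r,
      ∃ H ⊆ S, m ≤ H.card ∧ ∃ k, ∀ F ⊆ H, F.card = a → c F = k := by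
  induction a generalizing m with
  | zero =>
    refine ⟨m, fun S hS c => ⟨S, subset_rfl, hS, c ∅, fun F _ hF => ?_⟩⟩
    rw [Finset.card_eq_zero.1 hF]
  | succ a ih =>
    -- Among `r * m` points, some colour of the minimum is taken by at least `m`.
    obtain ⟨N, hN⟩ := exists_subset_color_eq_min ih (r * m)
    refine ⟨N, fun S hS c => ?_⟩
    obtain ⟨H, hH, hc, d, hd⟩ := hN S hS c
    obtain ⟨k, -, hk⟩ := Finset.exists_le_card_fiber_of_mul_le_card_of_maps_to
      (s := H) (t := (Finset.univ : Finset (Fin r))) (f := d) (n := m) (by simp)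
      ⟨0, Finset.mem_univ _⟩ (by simpa using hc)
    refine ⟨H.filter (fun x => d x = k), (Finset.filter_subset _ _).trans hH, hk, k, ?_⟩
    intro F hF hFa
    have hne : F.Nonempty := Finset.card_pos.1 (by omega)
    have hmem := Finset.mem_filter.1 (hF (F.min'_mem hne))
    have := hd _ hmem.1 (F.erase (F.min' hne))
      ((Finset.erase_subset _ _).trans (hF.trans (Finset.filter_subset _ _)))
      (fun y hy => lt_of_le_of_ne (F.min'_le y (Finset.mem_of_mem_erase hy))
        (Finset.ne_of_mem_erase hy).symm)
      (by rw [Finset.card_erase_of_mem (F.min'_mem hne)]; omega)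
    rwa [Finset.insert_erase (F.min'_mem hne), hmem.2] at this

/-- Ramsey's theorem for strictly monotone maps between finite linear orders. -/
theorem exists_ramsey_strictMono (A B : Type u) [LinearOrder A] [LinearOrder B] [Finite A]
    [Finite B] (r : ℕ) [NeZero r] :
    ∃ N : ℕ, ∀ c : (A → Fin N) → Fin r, ∃ s : B → Fin N, StrictMono s ∧
      ∀ h h' : A → B, StrictMono h → StrictMono h' → c (s ∘ h) = c (s ∘ h') := by
  classical
  have := Fintype.ofFinite A
  have := Fintype.ofFinite B
  obtain ⟨N, hN⟩ := exists_homogeneous_subset r (Fintype.card A) (Fintype.card B)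
  refine ⟨N, fun c => ?_⟩
  -- A strictly monotone map is determined by its image, so a colouring of maps is a colouring of
  -- sets; the value `0` on other sets is irrelevant.
  let c' : Finset ℕ → Fin r := fun F =>
    if h : ∃ u : A → Fin N, StrictMono u ∧ Finset.univ.image (fun x => (u x : ℕ)) = F
    then c h.choose else 0
  have hc' : ∀ u : A → Fin N, StrictMono u →
      c' (Finset.univ.image (fun x => (u x : ℕ))) = c u := by
    intro u hu
    have h : ∃ u' : A → Fin N, StrictMono u' ∧ Finset.univ.image (fun x => (u' x : ℕ)) =
      Finset.univ.image (fun x => (u x : ℕ)) := ⟨u, hu, rfl⟩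
    have h1 : h.choose = u := by
      refine (StrictMono.range_inj h.choose_spec.1 hu).1 ?_
      have := congrArg (fun F : Finset ℕ => (F : Set ℕ)) h.choose_spec.2
      simp only [Finset.coe_image, Finset.coe_univ, Set.image_univ] at this
      have h2 : ∀ w : A → Fin N, Set.range (fun x => (w x : ℕ)) = Fin.val '' Set.range w :=
        fun w => by rw [← Set.range_comp]; rfl
      rw [h2, h2] at this
      exact (Set.image_injective.2 Fin.val_injective) this
    simp only [c', dif_pos h, h1]
  obtain ⟨H, hH, hcard, k, hk⟩ := hN (Finset.range N) (by simp) c'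
  obtain ⟨H', hH', hcard'⟩ := Finset.exists_subset_card_eq hcard
  let e := (Fintype.orderIsoFinOfCardEq B rfl).symm.trans (H'.orderIsoOfFin hcard')
  have he : ∀ x, (e x : ℕ) < N := fun x => Finset.mem_range.1 (hH (hH' (e x).2))
  let s : B → Fin N := fun x => ⟨e x, he x⟩
  have hs : StrictMono s := fun x y hxy => by
    have := e.strictMono hxy
    exact this
  refine ⟨s, hs, fun h h' hh hh' => ?_⟩
  have key : ∀ h : A → B, StrictMono h → c (s ∘ h) = k := fun h hh => by
    rw [← hc' _ (hs.comp hh)]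
    apply hk
    · intro y hy
      obtain ⟨x, -, rfl⟩ := Finset.mem_image.1 hy
      exact hH' (e (h x)).2
    · exact Finset.card_image_of_injective _ (Fin.val_injective.comp (hs.comp hh).injective)
  rw [key h hh, key h' hh']

/-! ### The partite construction -/

/-- `e` is a map over `t` that preserves the labels of pairs. -/
structure IsLabelledOver {A X N P : Type*} (t : A → N) (p : X → N) (fA : A → A → P)
    (f : X → X → P) (e : A → X) : Prop where
  proj : ∀ j, p (e j) = t j
  map : ∀ j j', f (e j) (e j') = fA j j'

theorem IsLabelledOver.comp {A X Y N P : Type*} {t : A → N} {p : X → N} {q : Y → N}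
    {fA : A → A → P} {f : X → X → P} {f' : Y → Y → P} {e : A → X} {g : X → Y}
    (hg : IsLabelledOver p q f f' g) (he : IsLabelledOver t p fA f e) :
    IsLabelledOver t q fA f' (g ∘ e) :=
  ⟨fun j => (hg.proj _).trans (he.proj j), fun j j' => (hg.map _ _).trans (he.map j j')⟩

instance {α ι : Type*} [Finite α] [Finite ι] : Finite (Combinatorics.Line α ι) :=
  Finite.of_injective Combinatorics.Line.idxFun fun _ _ h => Combinatorics.Line.ext h

/-- The label of a pair in a power: the default value `d`, unless some coordinate differs. -/
noncomputable def powerLabel {ι P : Type*} (d : P) (w : ι → P) : P :=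
  open Classical in if h : ∃ i, w i ≠ d then w h.choose else d

/-- This is the situation on a combinatorial line: the fixed coordinates show the default `d`, the
moving ones show `p`. -/
theorem powerLabel_eq {ι P : Type*} {d p : P} {w : ι → P} (h : ∀ i, w i = d ∨ w i = p)
    {i₀ : ι} (h₀ : w i₀ = p) : powerLabel d w = p := by
  unfold powerLabel
  split_ifs with hw
  · exact (h _).resolve_left hw.choose_spec
  · push Not at hw
    rw [← h₀, hw]

/-- One step of the partite construction: labelled maps over a single injective `t` are
made homogeneous. -/
theorem exists_homogeneous_over {A X : Type u} {N P : Type*} [Finite A] [Finite X] (r : ℕ) {t : A → N}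
    (ht : Function.Injective t) (p : X → N) (fA : A → A → P) (f : X → X → P) :
    ∃ (Y : Type u) (_ : Finite Y) (q : Y → N) (f' : Y → Y → P), ∀ χ : (A → Y) → Fin r,
      ∃ g : X → Y, IsLabelledOver p q f f' g ∧ ∀ e e' : A → X,
        IsLabelledOver t p fA f e → IsLabelledOver t p fA f e' → χ (g ∘ e) = χ (g ∘ e') := by
  classical
  -- The Hales–Jewett alphabet. A word over `α` is read coordinatewise as a map from `A` into the
  -- power `ι → X`.
  let α := {e : A → X // IsLabelledOver t p fA f e}
  obtain ⟨ι, _, hι⟩ := Combinatorics.Line.exists_mono_in_high_dimension α (Fin r)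
  let mv : Combinatorics.Line α ι → ι := fun (l : Combinatorics.Line α ι) => l.proper.choose
  have hmv : ∀ l : Combinatorics.Line α ι, l.idxFun (mv l) = none := fun l => l.proper.choose_spec
  -- Over the image of `t` the fibres are replaced by powers. Points of `X` elsewhere get one copy
  -- for each line, whose labels to the powers are read off at a moving coordinate `mv l` of that
  -- line.
  let Y := (A × (ι → X)) ⊕ (Combinatorics.Line α ι × X)
  let q : Y → N := Sum.elim (fun y => t y.1) (fun y => p y.2)
  let f' : Y → Y → P := fun y y' => match y, y' with
    | .inl (j, w), .inl (j', w') => powerLabel (fA j j') (fun i => f (w i) (w' i))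
    | .inl (_, w), .inr (l, x') => f (w (mv l)) x'
    | .inr (l, x), .inl (_, w') => f x (w' (mv l))
    | .inr (_, x), .inr (_, x') => f x x'
  refine ⟨Y, inferInstance, q, f', fun χ => ?_⟩
  obtain ⟨l, k, hk⟩ := hι (fun w => χ (fun j => .inl (j, fun i => (w i).1 j)))
  -- The monochromatic line as an embedding of a fibre: `x` at moving coordinates, the fixed letter
  -- evaluated at `j` elsewhere.
  let pt : A → X → ι → X := fun j x i => ((l.idxFun i).map (fun e => e.1 j)).getD x
  have hpt : ∀ j x, pt j x (mv l) = x := fun j x => by simp [pt, hmv]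
  let g : X → Y := fun x => if h : ∃ j, t j = p x then .inl (h.choose, pt h.choose x)
    else .inr (l, x)
  have hg₁ : ∀ x j, t j = p x → g x = .inl (j, pt j x) := fun x j hj => by
    have h : ∃ j, t j = p x := ⟨j, hj⟩
    have h1 : h.choose = j := ht (h.choose_spec.trans hj.symm)
    simp only [g, dif_pos h, h1]
  have hg₂ : ∀ x, (¬ ∃ j, t j = p x) → g x = .inr (l, x) := fun x h => by
    simp only [g, dif_neg h]
  refine ⟨g, ⟨fun x => ?_, fun x x' => ?_⟩, fun e e' he he' => ?_⟩
  · by_cases h : ∃ j, t j = p x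
    · obtain ⟨j, hj⟩ := h
      rw [hg₁ x j hj]
      exact hj
    · rw [hg₂ x h]
      rfl
  · by_cases h : ∃ j, t j = p x <;> by_cases h' : ∃ j, t j = p x'
    · obtain ⟨j, hj⟩ := h
      obtain ⟨j', hj'⟩ := h'
      rw [hg₁ x j hj, hg₁ x' j' hj']
      refine powerLabel_eq (i₀ := mv l) (fun i => ?_) (by rw [hpt, hpt])
      cases hi : l.idxFun i with
      | none => right; simp [pt, hi]
      | some e => left; simpa [pt, hi] using e.2.map j j'
    · obtain ⟨j, hj⟩ := h
      rw [hg₁ x j hj, hg₂ x' h']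
      change f (pt j x (mv l)) x' = _
      rw [hpt]
    · obtain ⟨j', hj'⟩ := h'
      rw [hg₂ x h, hg₁ x' j' hj']
      change f x (pt j' x' (mv l)) = _
      rw [hpt]
    · rw [hg₂ x h, hg₂ x' h']
  -- `g ∘ e` is the point of the line `l` with parameter `e`, so its colour is that of the line.
  · have key : ∀ e (he : IsLabelledOver t p fA f e), χ (g ∘ e) = k := fun e he => by
      rw [← hk ⟨e, he⟩]
      congr 1
      funext j
      rw [Function.comp_apply, hg₁ (e j) j (he.proj j).symm]
      congr 2
      funext i
      simp only [pt, Combinatorics.Line.coe_apply]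
      cases l.idxFun i <;> rfl
    rw [key e he, key e' he']

/-- The iterated partite construction: labelled maps over each member of a finite family are
made homogeneous. -/
theorem exists_homogeneous_over_finset {A : Type u} {N P : Type*} [Finite A] (r : ℕ) (fA : A → A → P)
    (S : Finset (A → N)) (hS : ∀ t ∈ S, Function.Injective t) :
    ∀ (X : Type u) [Finite X] (p : X → N) (f : X → X → P),
    ∃ (Y : Type u) (_ : Finite Y) (q : Y → N) (f' : Y → Y → P), ∀ χ : (A → Y) → Fin r,
      ∃ g : X → Y, IsLabelledOver p q f f' g ∧ ∀ t ∈ S, ∀ e e' : A → X,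
        IsLabelledOver t p fA f e → IsLabelledOver t p fA f e' → χ (g ∘ e) = χ (g ∘ e') := by
  classical
  induction S using Finset.induction_on with
  | empty =>
    intro X _ p f
    exact ⟨X, inferInstance, p, f, fun χ => ⟨id, ⟨fun _ => rfl, fun _ _ => rfl⟩, by simp⟩⟩
  | insert t S _ ih =>
    intro X _ p f
    obtain ⟨Y, _, q, f', hY⟩ := exists_homogeneous_over r
      (hS t (Finset.mem_insert_self _ _)) p fA f
    obtain ⟨Z, _, q', f'', hZ⟩ := ih (fun t ht => hS t (Finset.mem_insert_of_mem ht)) Y q f'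
    refine ⟨Z, inferInstance, q', f'', fun χ => ?_⟩
    obtain ⟨g₂, hg₂, h₂⟩ := hZ χ
    -- The colouring is pulled back along `g₂`. Homogeneity over the other projections survives
    -- because `g₁` carries labelled maps to labelled maps.
    obtain ⟨g₁, hg₁, h₁⟩ := hY (fun e => χ (g₂ ∘ e))
    refine ⟨g₂ ∘ g₁, hg₂.comp hg₁, fun t' ht' e e' he he' => ?_⟩
    rcases Finset.mem_insert.1 ht' with rfl | ht'
    · exact h₁ e e' he he'
    · exact h₂ t' ht' _ _ (hg₁.comp he) (hg₁.comp he')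

/-- `h` is strictly monotone and preserves the labels of pairs. -/
structure IsLabelledEmb {A V P : Type*} [Preorder A] [Preorder V] (fA : A → A → P)
    (f : V → V → P) (h : A → V) : Prop where
  strictMono : StrictMono h
  map : ∀ x y, f (h x) (h y) = fA x y

/-- The class of finite linear orders with labelled pairs has the Ramsey property
(for embeddings). -/
theorem exists_ramsey_labelled {P : Type*} (A B : Type u) [LinearOrder A] [LinearOrder B]
    [Finite A] [Finite B] (fA : A → A → P) (fB : B → B → P) (r : ℕ) [NeZero r] :
    ∃ (V : Type u) (_ : LinearOrder V) (_ : Finite V) (f : V → V → P),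
      ∀ χ : (A → V) → Fin r, ∃ g : B → V, IsLabelledEmb fB f g ∧
        ∀ h h' : A → B, IsLabelledEmb fA fB h → IsLabelledEmb fA fB h' →
          χ (g ∘ h) = χ (g ∘ h') := by
  classical
  obtain ⟨N, hN⟩ := exists_ramsey_strictMono A B r
  have hfin : {t : A → Fin N | StrictMono t}.Finite := Set.toFinite _
  -- The initial partite system is a disjoint union of copies of `B`, one over each map `B → Fin N`.
  obtain ⟨V, _, q, f, hV⟩ := exists_homogeneous_over_finset r fA hfin.toFinset
    (fun t ht => ((Set.Finite.mem_toFinset _).1 ht).injective) ((B → Fin N) × B)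
    (fun x => x.1 x.2) (fun x y => fB x.2 y.2)
  have := Fintype.ofFinite V
  let e := Fintype.equivFin V
  -- The order inside a fibre of `q` is arbitrary: the copy of `B` that is used meets each fibre at
  -- most once.
  let key : V → Fin N ×ₗ Fin (Fintype.card V) := fun v => toLex (q v, e v)
  have hkey : Function.Injective key := fun v w h => by
    have : (q v, e v) = (q w, e w) := toLex.injective h
    exact e.injective (Prod.ext_iff.1 this).2
  let _ : LinearOrder V := LinearOrder.lift' key hkey
  have hlt : ∀ v w : V, q v < q w → v < w := fun v w h => by
    change key v < key w
    exact Prod.Lex.toLex_lt_toLex.2 (Or.inl h)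
  refine ⟨V, inferInstance, inferInstance, f, fun χ => ?_⟩
  obtain ⟨g, hg, hχ⟩ := hV χ
  let isOver : (A → Fin N) → (A → (B → Fin N) × B) → Prop := fun t e =>
    IsLabelledOver (t) (fun x : (B → Fin N) × B => x.1 x.2) fA (fun x y => fB x.2 y.2) e
  -- After homogenisation the colour depends only on the projection `t`, so Ramsey's theorem applies
  -- to projections. The copy of `B` over the resulting `s` is the one wanted.
  obtain ⟨s, hs, hc⟩ := hN (fun t => if h : ∃ e, isOver t e then χ (g ∘ h.choose) else 0)
  let i : B → (B → Fin N) × B := fun b => (s, b)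
  have hi : IsLabelledOver (s) (fun x : (B → Fin N) × B => x.1 x.2) fB
      (fun x y => fB x.2 y.2) i := ⟨fun _ => rfl, fun _ _ => rfl⟩
  refine ⟨g ∘ i, ⟨fun x y hxy => hlt _ _ ?_, (hg.comp hi).map⟩, fun h h' hh hh' => ?_⟩
  · rw [(hg.comp hi).proj, (hg.comp hi).proj]
    exact hs hxy
  · have main : ∀ h : A → B, IsLabelledEmb fA fB h →
        (if h : ∃ e, isOver (s ∘ h) e then χ (g ∘ h.choose) else 0) = χ ((g ∘ i) ∘ h) := by
      intro h hh
      have h1 : isOver (s ∘ h) (i ∘ h) := ⟨fun _ => rfl, hh.map⟩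
      have h2 : ∃ e, isOver (s ∘ h) e := ⟨_, h1⟩
      rw [dif_pos h2]
      refine hχ (s ∘ h) ((Set.Finite.mem_toFinset _).2 ?_) _ _ h2.choose_spec h1
      exact fun x y hxy => hs (hh.strictMono hxy)
    rw [← main h hh, ← main h' hh']
    exact hc h h' hh.strictMono hh'.strictMono

/-! ### From embeddings to copies -/

/-- The arrow relation follows from the corresponding statement on colourings of embeddings. -/
theorem arrows_of_embeddings {L : FirstOrder.Language.{0, 0}} {C B A : Type u} [L.Structure C]
    [L.Structure B] [L.Structure A] {r : ℕ}
    (H : ∀ χ : (A ↪[L] C) → Fin r, ∃ g : B ↪[L] C, ∀ h h' : A ↪[L] B,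
      χ (g.comp h) = χ (g.comp h')) : Arrows L C B A r := by
  intro c
  have hcopy : ∀ e : A ↪[L] C, e.toHom.range ∈ Copies L C A := fun e => ⟨e.equivRange.symm⟩
  obtain ⟨g, hg⟩ := H fun e => c ⟨_, hcopy e⟩
  refine ⟨g.toHom.range, ⟨g.equivRange.symm⟩, ?_⟩
  have key : ∀ A₁ : Copies L C A, A₁.1 ≤ g.toHom.range →
      ∃ h : A ↪[L] B, A₁ = ⟨_, hcopy (g.comp h)⟩ := by
    rintro ⟨S, ⟨e⟩⟩ hS
    refine ⟨g.equivRange.symm.toEmbedding.comp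
      ((Substructure.inclusion hS).comp e.symm.toEmbedding), Subtype.ext ?_⟩
    have hval : ∀ a : A, g (g.equivRange.symm ((Substructure.inclusion hS) (e.symm a))) =
        (e.symm a : C) := fun a => by
      exact congrArg Subtype.val (g.equivRange.apply_symm_apply _)
    ext x
    constructor
    · intro hx
      refine ⟨e ⟨x, hx⟩, ?_⟩
      refine (hval _).trans ?_
      exact congrArg Subtype.val (e.symm_apply_apply ⟨x, hx⟩)
    · rintro ⟨a, rfl⟩
      have : (e.symm a : C) ∈ S := (e.symm a).2
      rw [← hval a] at this
      exact this
  intro A₁ A₂ h₁ h₂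
  obtain ⟨h, rfl⟩ := key A₁ h₁
  obtain ⟨h', rfl⟩ := key A₂ h₂
  exact hg h h'

/-- A class in which there is at most one embedding between any two structures has the Ramsey
property. -/
theorem hasRamseyProperty_of_subsingleton {L : FirstOrder.Language.{0, 0}}
    {K : Set (Bundled.{u} L.Structure)}
    (hK : ∀ A ∈ K, ∀ B ∈ K, Subsingleton (A ↪[L] B)) : HasRamseyProperty L K := by
  intro r A hA B hB
  refine ⟨B, hB, arrows_of_embeddings fun χ => ⟨Embedding.refl L B, fun h h' => ?_⟩⟩
  have := hK A hA B hB
  rw [Subsingleton.elim h h']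

/-! ### Structures with edges, an order and unary predicates -/

section StarStructures

variable {κ : Type} {A B M : Type*} [(starLang κ).Structure A] [(starLang κ).Structure B]
  [(starLang κ).Structure M]

theorem map_sEdge (e : A ↪[starLang κ] B) (x y : A) :
    SEdge κ (e x) (e y) ↔ SEdge κ x y := by
  have h := e.map_rel (StarRel.edge : StarRel κ 2) ![x, y]
  rwa [show e ∘ ![x, y] = ![e x, e y] from funext fun i => by fin_cases i <;> rfl] at h

theorem map_sLt (e : A ↪[starLang κ] B) (x y : A) : SLt κ (e x) (e y) ↔ SLt κ x y := by
  have h := e.map_rel (StarRel.lt : StarRel κ 2) ![x, y]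
  rwa [show e ∘ ![x, y] = ![e x, e y] from funext fun i => by fin_cases i <;> rfl] at h

theorem map_sPred (e : A ↪[starLang κ] B) (i : κ) (x : A) : SPred i (e x) ↔ SPred i x := by
  have h := e.map_rel (StarRel.pred i : StarRel κ 1) ![x]
  rwa [show e ∘ ![x] = ![e x] from funext fun i => by fin_cases i; rfl] at h

/-- An injective map that preserves and reflects edges, order and predicates is an embedding. -/
def starEmbedding (e : A → B) (he : Function.Injective e)
    (hE : ∀ x y, SEdge κ (e x) (e y) ↔ SEdge κ x y) (hL : ∀ x y, SLt κ (e x) (e y) ↔ SLt κ x y)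
    (hP : ∀ (i : κ) x, SPred i (e x) ↔ SPred i x) : A ↪[starLang κ] B where
  toFun := e
  inj' := he
  map_fun' := fun f _ => Empty.elim f
  map_rel' := fun R v => by
    have h2 : ∀ w : Fin 2 → A, w = ![w 0, w 1] := fun w => by
      ext i; fin_cases i <;> rfl
    have h1 : ∀ w : Fin 1 → A, w = ![w 0] := fun w => by
      ext i; fin_cases i; rfl
    have h2' : ∀ w : Fin 2 → A, e ∘ w = ![e (w 0), e (w 1)] := fun w => by
      ext i; fin_cases i <;> rfl
    have h1' : ∀ w : Fin 1 → A, e ∘ w = ![e (w 0)] := fun w => by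
      ext i; fin_cases i; rfl
    cases R with
    | edge =>
      have h := hE (v 0) (v 1)
      unfold SEdge at h
      rwa [← h2, ← h2'] at h
    | lt =>
      have h := hL (v 0) (v 1)
      unfold SLt at h
      rwa [← h2, ← h2'] at h
    | pred i =>
      have h := hP i (v 0)
      unfold SPred at h
      rwa [← h1, ← h1'] at h

/-- The label of a pair of points: the edge relation on the pair, and the predicates of the first
point. -/
def starLabel (κ : Type) {A : Type*} [(starLang κ).Structure A] (x y : A) : Prop × (κ → Prop) :=
  (SEdge κ x y, fun i => SPred i x)

theorem map_starLabel (e : A ↪[starLang κ] B) (x y : A) :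
    starLabel κ (e x) (e y) = starLabel κ x y := by
  simp only [starLabel, map_sEdge, map_sPred]

theorem isStrictTotalOrder_of_embedding (e : A ↪[starLang κ] B) [IsStrictTotalOrder B (SLt κ)] :
    IsStrictTotalOrder A (SLt κ) :=
  RelEmbedding.isStrictTotalOrder (⟨e.toEmbedding, map_sLt e _ _⟩ : SLt κ (T := A) ↪r SLt κ (T := B))

end StarStructures

theorem finite_of_mem_age {κ : Type} {M : Type u} [(starLang κ).Structure M]
    {A : Bundled.{u} (starLang κ).Structure} (hA : A ∈ (starLang κ).age M) : Finite A := by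
  obtain ⟨S, hS⟩ := hA.1
  have h : (S : Set A) = Set.univ := by
    rw [← Substructure.closure_eq_of_isRelational (starLang κ) (S : Set A), hS]
    rfl
  exact Set.finite_univ_iff.1 (h ▸ S.finite_toSet)

/-- `φ` realizes the labelled linear order `(V, f)` in `M`, as far as its labels occur in `M`. -/
structure Realizes (κ : Type) {V M : Type*} [LinearOrder V] [(starLang κ).Structure M]
    (f : V → V → Prop × (κ → Prop)) (φ : V → M) : Prop where
  diag : ∀ x (a : M), f x x = starLabel κ a a → starLabel κ (φ x) (φ x) = starLabel κ a a
  pair : ∀ x y (a b : M), x < y → SLt κ a b → f x x = starLabel κ a a → f y y = starLabel κ b b →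
    f x y = starLabel κ a b → f y x = starLabel κ b a → SLt κ (φ x) (φ y) ∧
      starLabel κ (φ x) (φ y) = starLabel κ a b ∧ starLabel κ (φ y) (φ x) = starLabel κ b a

/-- If `M` is linearly ordered and all finite labelled linear orders can be realized in `M`, then
the age of `M` has the Ramsey property. -/
theorem hasRamseyProperty_age_of_realizes {κ : Type} (M : Type u) [(starLang κ).Structure M]
    [IsStrictTotalOrder M (SLt κ)]
    (hM : ∀ (V : Type u) [LinearOrder V] [Finite V] (f : V → V → Prop × (κ → Prop)),
      ∃ φ : V → M, Realizes κ f φ) :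
    HasRamseyProperty (starLang κ) ((starLang κ).age M) := by
  classical
  intro r A hA B hB
  rcases Nat.eq_zero_or_pos r with rfl | hr
  -- With no colours, a colouring exists only if there are no copies of `A`.
  · exact ⟨B, hB, fun c => ⟨⊤, ⟨Substructure.topEquiv⟩, fun A₁ => (c A₁).elim0⟩⟩
  have : NeZero r := ⟨hr.ne'⟩
  have := finite_of_mem_age hA
  have := finite_of_mem_age hB
  obtain ⟨-, ⟨a⟩⟩ := hA
  obtain ⟨-, ⟨b⟩⟩ := hB
  have := isStrictTotalOrder_of_embedding a
  have := isStrictTotalOrder_of_embedding b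
  let _ : LinearOrder A := linearOrderOfSTO (SLt κ)
  let _ : LinearOrder B := linearOrderOfSTO (SLt κ)
  obtain ⟨V, _, _, f, hV⟩ := exists_ramsey_labelled A B (starLabel κ) (starLabel κ) r
  obtain ⟨φ, hφ⟩ := hM V f
  let S : (starLang κ).Substructure M := Substructure.closure _ (Set.range φ)
  have hS : ∀ x, φ x ∈ S := fun x => Substructure.subset_closure ⟨x, rfl⟩
  refine ⟨Bundled.of S, age.fg_substructure (Substructure.fg_closure (Set.finite_range φ)),
    arrows_of_embeddings fun χ => ?_⟩
  have hlab : ∀ h : A ↪[starLang κ] B, IsLabelledEmb (starLabel κ) (starLabel κ) h := fun h =>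
    ⟨fun x y hxy => (map_sLt h x y).2 hxy, map_starLabel h⟩
  -- Maps into `V` that do not become embeddings under `φ` get a dummy colour; none arises from `A`
  -- inside the copy of `B`.
  obtain ⟨g, hg, hχ⟩ := hV fun e =>
    if h : ∃ e' : A ↪[starLang κ] S, ∀ x, (e' x : M) = φ (e x) then χ h.choose else 0
  have hpair : ∀ x y, x < y → SLt κ (φ (g x)) (φ (g y)) ∧
      starLabel κ (φ (g x)) (φ (g y)) = starLabel κ x y ∧
      starLabel κ (φ (g y)) (φ (g x)) = starLabel κ y x := fun x y hxy => by
    have := hφ.pair (g x) (g y) (b x) (b y) (hg.strictMono hxy) ((map_sLt b x y).2 hxy)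
    simp only [map_starLabel, hg.map, forall_const] at this
    exact this
  have hdiag : ∀ x, starLabel κ (φ (g x)) (φ (g x)) = starLabel κ x x := fun x => by
    have := hφ.diag (g x) (b x)
    simpa only [map_starLabel, hg.map, forall_const] using this
  have hlabel : ∀ x y, starLabel κ (φ (g x)) (φ (g y)) = starLabel κ x y := fun x y => by
    rcases lt_trichotomy x y with h | rfl | h
    · exact (hpair x y h).2.1
    · exact hdiag x
    · exact (hpair y x h).2.2
  have hlt : ∀ x y, SLt κ (φ (g x)) (φ (g y)) ↔ SLt κ x y := fun x y => by
    refine ⟨fun h => ?_, fun h => (hpair x y h).1⟩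
    rcases lt_trichotomy x y with h' | rfl | h'
    · exact h'
    · exact (irrefl_of (SLt κ) _ h).elim
    · exact (asymm_of (SLt κ) h (hpair y x h').1).elim
  have hinj : Function.Injective fun x => φ (g x) := fun x y hxy => by
    have hxy : φ (g x) = φ (g y) := hxy
    by_contra hne
    rcases lt_or_gt_of_ne hne with h | h <;> have := (hpair _ _ h).1 <;>
      exact irrefl_of (SLt κ) _ (hxy ▸ this)
  let G₀ : B ↪[starLang κ] M := starEmbedding (fun x => φ (g x)) hinj
    (fun x y => iff_of_eq (congrArg Prod.fst (hlabel x y))) hlt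
    (fun i x => iff_of_eq (congrFun (congrArg Prod.snd (hdiag x)) i))
  let G : B ↪[starLang κ] S := G₀.codRestrict S fun x => hS (g x)
  refine ⟨G, fun h h' => ?_⟩
  have main : ∀ h : A ↪[starLang κ] B,
      (if h : ∃ e' : A ↪[starLang κ] S, ∀ x, (e' x : M) = φ ((g ∘ h) x) then χ h.choose else 0) =
        χ (G.comp h) := fun h => by
    have hex : ∃ e' : A ↪[starLang κ] S, ∀ x, (e' x : M) = φ ((g ∘ h) x) :=
      ⟨G.comp h, fun x => rfl⟩
    rw [dif_pos hex]
    congr 1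
    ext x
    exact hex.choose_spec x
  exact (main h).symm.trans ((hχ h h' (hlab h) (hlab h')).trans (main h'))

theorem starLabel_eq_iff {κ : Type} {A B : Type*} [(starLang κ).Structure A]
    [(starLang κ).Structure B] {x y : A} {a b : B} : starLabel κ x y = starLabel κ a b ↔
      (SEdge κ x y ↔ SEdge κ a b) ∧ ∀ i : κ, SPred i x ↔ SPred i a := by
  simp only [starLabel, Prod.mk.injEq, funext_iff, eq_iff_iff]

/-- If the points of `M` are determined by the unary predicates, then the age of `M` has the Ramsey
property. -/
theorem hasRamseyProperty_age_of_pred_ext {κ : Type} (M : Type u) [(starLang κ).Structure M]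
    (hM : ∀ x y : M, (∀ i : κ, SPred i x ↔ SPred i y) → x = y) :
    HasRamseyProperty (starLang κ) ((starLang κ).age M) := by
  refine hasRamseyProperty_of_subsingleton fun A _ B hB => ⟨fun e e' => ?_⟩
  obtain ⟨-, ⟨b⟩⟩ := hB
  ext x
  refine b.injective (hM _ _ fun i => ?_)
  rw [map_sPred, map_sPred, map_sPred, map_sPred]

/-! ### Reduction to the structure on a single part -/

/-- Every finite linear order, with prescribed predicates and prescribed edges between increasing
pairs, can be realized in `T`, as far as the prescribed edges are consistent with the order and the
predicates. -/
def RealizesOrders (κ : Type) (T : Type u) [(starLang κ).Structure T] : Prop :=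
  ∀ (V : Type u) [LinearOrder V] [Finite V] (a : V → T) (d : V → V → Prop), ∃ ψ : V → T,
    (∀ x (i : κ), SPred i (ψ x) ↔ SPred i (a x)) ∧ ∀ x y, x < y → SLt κ (ψ x) (ψ y) ∧
      ∀ s t : T, SLt κ s t → (∀ i : κ, SPred i (ψ x) ↔ SPred i s) →
        (∀ i : κ, SPred i (ψ y) ↔ SPred i t) → (d x y ↔ SEdge κ s t) →
          (SEdge κ (ψ x) (ψ y) ↔ SEdge κ s t)

namespace CopiesOf

variable {n : ℕ} {κ : Type} {T : Type u} [(starLang κ).Structure T]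

theorem sEdge_iff (x y : CopiesOf n T) :
    SEdge (κ ⊕ Fin n) x y ↔ x.1 = y.1 ∧ SEdge κ x.2 y.2 := Iff.rfl

theorem sLt_iff (x y : CopiesOf n T) :
    SLt (κ ⊕ Fin n) x y ↔ x.1 < y.1 ∨ x.1 = y.1 ∧ SLt κ x.2 y.2 := Iff.rfl

theorem sPred_inr_iff (i : Fin n) (x : CopiesOf n T) :
    SPred (Sum.inr i : κ ⊕ Fin n) x ↔ x.1 = i := Iff.rfl

instance [IsStrictTotalOrder T (SLt κ)] :
    IsStrictTotalOrder (CopiesOf n T) (SLt (κ ⊕ Fin n)) := by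
  classical
  let _ : LinearOrder T := linearOrderOfSTO (SLt κ)
  exact RelEmbedding.isStrictTotalOrder (s := fun x y : Fin n ×ₗ T => x < y)
    ⟨⟨fun x => toLex (x.1, x.2), fun _ _ h => h⟩,
      fun {x y} => (Prod.Lex.toLex_lt_toLex (x := (x.1, x.2)) (y := (y.1, y.2))).trans
        (sLt_iff x y).symm⟩

/-- The Ramsey property of the age of `I_n[T]*` follows from a realization property of `T*`. -/
theorem hasRamseyProperty_age [IsStrictTotalOrder T (SLt κ)]
    (hE : IsTournamentRel (T := T) (SEdge κ)) (hT : RealizesOrders κ T) (n : ℕ) :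
    HasRamseyProperty (starLang (κ ⊕ Fin n)) ((starLang (κ ⊕ Fin n)).age (CopiesOf n T)) := by
  classical
  rcases isEmpty_or_nonempty (CopiesOf n T) with _ | ⟨⟨m₀⟩⟩
  · exact hasRamseyProperty_age_of_pred_ext _ fun x => isEmptyElim x
  refine hasRamseyProperty_age_of_realizes _ fun V _ _ f => ?_
  -- The diagonal label prescribes the part and the predicates of `x`; labels that do not occur get
  -- the dummy point `m₀`.
  let a : V → CopiesOf n T := fun x =>
    if h : ∃ m : CopiesOf n T, f x x = starLabel (κ ⊕ Fin n) m m then h.choose else m₀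
  have ha : ∀ x (m : CopiesOf n T), f x x = starLabel (κ ⊕ Fin n) m m →
      (a x).1 = m.1 ∧ ∀ i : κ, SPred i (a x).2 ↔ SPred i m.2 := fun x m hm => by
    have h : ∃ m : CopiesOf n T, f x x = starLabel (κ ⊕ Fin n) m m := ⟨m, hm⟩
    have h1 : starLabel (κ ⊕ Fin n) (a x) (a x) = starLabel (κ ⊕ Fin n) m m := by
      rw [← hm]
      simp only [a, dif_pos h]
      exact h.choose_spec.symm
    have h2 := (starLabel_eq_iff.1 h1).2
    exact ⟨(h2 (Sum.inr m.1)).2 rfl, fun i => h2 (Sum.inl i)⟩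
  obtain ⟨ψ, hψp, hψ⟩ := hT V (fun x => (a x).2) (fun x y => (f x y).1)
  let φ : V → CopiesOf n T := fun x => ((a x).1, ψ x)
  have hpred : ∀ x (m : CopiesOf n T), f x x = starLabel (κ ⊕ Fin n) m m →
      ∀ i : κ ⊕ Fin n, SPred i (φ x) ↔ SPred i m := fun x m hm i => by
    cases i with
    | inl i => exact (hψp x i).trans ((ha x m hm).2 i)
    | inr i => rw [sPred_inr_iff, sPred_inr_iff, ← (ha x m hm).1]
  refine ⟨φ, fun x m hm => starLabel_eq_iff.2 ⟨?_, hpred x m hm⟩,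
    fun x y m m' hxy hmm' hm hm' h h' => ?_⟩
  · rw [sEdge_iff, sEdge_iff]
    simp [hE.1]
  have h1 : (φ x).1 = m.1 := (ha x m hm).1
  have h2 : (φ y).1 = m'.1 := (ha y m' hm').1
  obtain ⟨hlt, hψe⟩ := hψ x y hxy
  rw [sLt_iff] at hmm' ⊢
  refine ⟨?_, ?_⟩
  · rw [h1, h2]
    exact hmm'.imp_right fun h => ⟨h.1, hlt⟩
  -- Only the upward edge is realized directly; the downward one is its negation, as `T` is a
  -- tournament.
  have hedge : (m.1 = m'.1 → (SEdge κ (ψ x) (ψ y) ↔ SEdge κ m.2 m'.2) ∧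
      (SEdge κ (ψ y) (ψ x) ↔ SEdge κ m'.2 m.2)) := fun heq => by
    have hlt' : SLt κ m.2 m'.2 := (hmm'.resolve_left (by simp [heq])).2
    have key := hψe m.2 m'.2 hlt' (fun i => hpred x m hm (Sum.inl i))
      (fun i => hpred y m' hm' (Sum.inl i)) (by
        rw [h]
        exact and_iff_right heq)
    have irr : ∀ s t : T, SLt κ s t → s ≠ t := fun s t h hst =>
      irrefl_of (SLt κ) t (hst ▸ h)
    have hx := hE.2 _ _ (irr _ _ hlt)
    have hx' := hE.2 _ _ (irr _ _ hlt')
    refine ⟨key, ?_⟩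
    unfold Xor at hx hx'
    tauto
  refine ⟨starLabel_eq_iff.2 ⟨?_, hpred x m hm⟩, starLabel_eq_iff.2 ⟨?_, hpred y m' hm'⟩⟩
  · rw [sEdge_iff, sEdge_iff, h1, h2]
    exact and_congr_right fun h => (hedge h).1
  · rw [sEdge_iff, sEdge_iff, h1, h2]
    exact and_congr_right fun h => (hedge h.symm).2

end CopiesOf

/-! ### The rationals -/

theorem IsRationalsStar.isStrictTotalOrder {T : Type u} [(starLang (Fin 0)).Structure T]
    (h : IsRationalsStar T) : IsStrictTotalOrder T (SLt (Fin 0)) := by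
  obtain ⟨e, he⟩ := h
  exact RelEmbedding.isStrictTotalOrder (s := fun x y : ℚ => x < y)
    ⟨e.toEmbedding, fun {x y} => (he x y).2.symm⟩

theorem IsRationalsStar.realizesOrders {T : Type u} [(starLang (Fin 0)).Structure T]
    (h : IsRationalsStar T) : RealizesOrders (Fin 0) T := by
  obtain ⟨e, he⟩ := h
  intro V _ _ a d
  obtain ⟨j⟩ := Order.embedding_from_countable_to_dense V ℚ
  refine ⟨fun x => e.symm (j x), fun x i => i.elim0, fun x y hxy => ?_⟩
  have hj : j x < j y := j.strictMono hxy
  refine ⟨by rw [(he _ _).2]; simpa using hxy, fun s t hst _ _ _ => ?_⟩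
  rw [(he _ _).1, (he _ _).1, ← (he s t).2]
  simpa [hst] using hxy

/-! ### The dense local order -/

/-- By irrationality of `π`. Hence the two halves cover `S(2)` and tangents are meaningful. -/
theorem RationalAngle.cos_ne_zero (x : RationalAngle) : x.1.cos ≠ 0 := by
  obtain ⟨x, q, rfl⟩ := x
  intro h
  rw [Real.Angle.cos_coe, Real.cos_eq_zero_iff] at h
  obtain ⟨k, hk⟩ := h
  refine irrational_pi ⟨q * 2 / (2 * k + 1), ?_⟩
  have h0 : (2 * k + 1 : ℝ) ≠ 0 := by
    have : (2 * k + 1 : ℤ) ≠ 0 := by omega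
    exact_mod_cast this
  push_cast
  rw [hk]
  field_simp

/-- The angle from `x` to `y` lies in `(0, π)` iff its sine is positive, and `sin (y - x) = cos x
cos y (tan y - tan x)`. The sign of the cosines is what reverses edges between halves. -/
theorem RationalAngle.edge_iff (x y : RationalAngle) :
    x.Edge y ↔ 0 < x.1.cos * y.1.cos * (y.1.tan - x.1.tan) := by
  have hx := x.cos_ne_zero
  have hy := y.cos_ne_zero
  unfold RationalAngle.Edge
  rw [Real.Angle.toReal_mem_Ioo_iff_sign_pos, Real.Angle.sign, sign_eq_one_iff, sub_eq_add_neg,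
    Real.Angle.sin_add, Real.Angle.cos_neg, Real.Angle.sin_neg, Real.Angle.tan_eq_sin_div_cos,
    Real.Angle.tan_eq_sin_div_cos]
  have : x.1.cos * y.1.cos * (y.1.sin / y.1.cos - x.1.sin / x.1.cos) =
      y.1.sin * x.1.cos + y.1.cos * -x.1.sin := by
    field_simp
    ring
  rw [this]

theorem RationalAngle.exists_cos_pos (k : ℕ) :
    ∃ x : RationalAngle, 0 < x.1.cos ∧ x.1.tan ∈ Set.Ioo (k : ℝ) (k + 1) := by
  obtain ⟨q, h₁, h₂⟩ := exists_rat_btwn (Real.arctan_strictMono (lt_add_one (k : ℝ)))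
  have h₃ := (Real.neg_pi_div_two_lt_arctan k).trans h₁
  have h₄ := h₂.trans (Real.arctan_lt_pi_div_two _)
  refine ⟨⟨_, q, rfl⟩, ?_, ?_⟩
  · simpa using Real.cos_pos_of_mem_Ioo ⟨h₃, h₄⟩
  · rw [← Real.arctan_tan h₃ h₄] at h₁ h₂
    simpa using And.intro (Real.arctan_strictMono.lt_iff_lt.1 h₁)
      (Real.arctan_strictMono.lt_iff_lt.1 h₂)

theorem RationalAngle.exists_cos_neg (k : ℕ) :
    ∃ x : RationalAngle, x.1.cos < 0 ∧ x.1.tan ∈ Set.Ioo (k : ℝ) (k + 1) := by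
  -- Adding `π` keeps the tangent and changes the half.
  obtain ⟨q, h₁, h₂⟩ := exists_rat_btwn
    (add_lt_add_left (Real.arctan_strictMono (lt_add_one (k : ℝ))) Real.pi)
  rw [← lt_sub_iff_add_lt] at h₁
  rw [← sub_lt_iff_lt_add] at h₂
  have h₃ := (Real.neg_pi_div_two_lt_arctan k).trans h₁
  have h₄ := h₂.trans (Real.arctan_lt_pi_div_two _)
  refine ⟨⟨_, q, rfl⟩, ?_, ?_⟩
  · simpa [Real.cos_sub_pi] using Real.cos_pos_of_mem_Ioo ⟨h₃, h₄⟩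
  · rw [← Real.arctan_tan h₃ h₄] at h₁ h₂
    simpa [Real.tan_sub_pi] using And.intro (Real.arctan_strictMono.lt_iff_lt.1 h₁)
      (Real.arctan_strictMono.lt_iff_lt.1 h₂)

/-- In `S(2)*` the order compares tangents. -/
theorem IsDenseLocalOrderStar.exists_tan {T : Type u} [(starLang (Fin 2)).Structure T]
    (h : IsDenseLocalOrderStar T) : ∃ e : T ≃ RationalAngle,
      (∀ x, SPred (0 : Fin 2) x ↔ (e x).1.cos < 0) ∧
      (∀ x, SPred (1 : Fin 2) x ↔ 0 < (e x).1.cos) ∧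
      (∀ x y, SEdge (Fin 2) x y ↔
        0 < (e x).1.cos * (e y).1.cos * ((e y).1.tan - (e x).1.tan)) ∧
      ∀ x y, SLt (Fin 2) x y ↔ (e x).1.tan < (e y).1.tan := by
  obtain ⟨⟨e, hE, h0, h1⟩, hlt⟩ := h
  have hE' := fun x y => (hE x y).trans (RationalAngle.edge_iff _ _)
  refine ⟨e, h0, h1, hE', fun x y => ?_⟩
  rw [hlt, hE', hE', h0, h0]
  rcases lt_or_gt_of_ne (e x).cos_ne_zero with hx | hx <;>
    rcases lt_or_gt_of_ne (e y).cos_ne_zero with hy | hy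
  · simp [hx, hy, mul_pos_of_neg_of_neg hx hy]
  · simp [hx, hy.not_gt, mul_comm (e y).1.cos,
      mul_pos_iff, (mul_neg_of_neg_of_pos hx hy), (mul_neg_of_neg_of_pos hx hy).not_gt]
  · simp [hx.not_gt, hy, mul_comm (e y).1.cos,
      mul_pos_iff, (mul_neg_of_pos_of_neg hx hy), (mul_neg_of_pos_of_neg hx hy).not_gt]
  · simp [hx.not_gt, hy.not_gt, mul_pos hx hy]

theorem IsDenseLocalOrderStar.isStrictTotalOrder {T : Type u} [(starLang (Fin 2)).Structure T]
    (hT : IsTournamentRel (T := T) (SEdge (Fin 2))) (h : IsDenseLocalOrderStar T) :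
    IsStrictTotalOrder T (SLt (Fin 2)) := by
  obtain ⟨e, -, -, hE, hlt⟩ := h.exists_tan
  refine RelEmbedding.isStrictTotalOrder (s := fun x y : ℝ => x < y)
    ⟨⟨fun x => (e x).1.tan, fun x y hxy => ?_⟩, fun {x y} => (hlt x y).symm⟩
  have hxy : (e x).1.tan = (e y).1.tan := hxy
  by_contra hne
  -- Equal tangents would exclude both edges.
  rcases hT.2 x y hne with h | h <;> simp [hE, hxy] at h

theorem IsDenseLocalOrderStar.sEdge_iff {T : Type u} [(starLang (Fin 2)).Structure T]
    (hT : IsTournamentRel (T := T) (SEdge (Fin 2))) (h : IsDenseLocalOrderStar T) {x y : T}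
    (hxy : SLt (Fin 2) x y) :
    SEdge (Fin 2) x y ↔ (SPred (0 : Fin 2) x ↔ SPred (0 : Fin 2) y) := by
  rcases (h.2 x y).1 hxy with ⟨h1, h2⟩ | ⟨h1, h2⟩
  · exact iff_of_true h2 h1
  · have hne : x ≠ y := fun heq => h1 (by rw [heq])
    refine iff_of_false (fun h3 => ?_) h1
    rcases hT.2 x y hne with h | h
    · exact h.2 h2
    · exact h.2 h3

theorem IsDenseLocalOrderStar.realizesOrders {T : Type u} [(starLang (Fin 2)).Structure T]
    (hT : IsTournamentRel (T := T) (SEdge (Fin 2))) (h : IsDenseLocalOrderStar T) :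
    RealizesOrders (Fin 2) T := by
  obtain ⟨e, h0, h1, -, hlt⟩ := h.exists_tan
  intro V _ _ a d
  have := Fintype.ofFinite V
  let k : V → Fin (Fintype.card V) := (Fintype.orderIsoFinOfCardEq V rfl).symm
  have hk : StrictMono k := OrderIso.strictMono _
  -- The element of rank `k x` goes to the prescribed half with tangent in `(k x, k x + 1)`;
  -- disjoint intervals make the map increasing.
  have hex : ∀ x, ∃ t : T, (∀ i : Fin 2, SPred i t ↔ SPred i (a x)) ∧
      (e t).1.tan ∈ Set.Ioo (k x : ℝ) (k x + 1) := fun x => by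
    rcases lt_or_gt_of_ne (e (a x)).cos_ne_zero with hc | hc
    · obtain ⟨t, ht, ht'⟩ := RationalAngle.exists_cos_neg (k x)
      refine ⟨e.symm t, fun i => ?_, by simpa using ht'⟩
      fin_cases i
      · exact iff_of_true ((h0 _).2 (by simpa using ht)) ((h0 _).2 hc)
      · exact iff_of_false (fun h => absurd ((h1 _).1 h) (by simpa using ht.le))
          (fun h => absurd ((h1 _).1 h) hc.not_gt)
    · obtain ⟨t, ht, ht'⟩ := RationalAngle.exists_cos_pos (k x)
      refine ⟨e.symm t, fun i => ?_, by simpa using ht'⟩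
      fin_cases i
      · exact iff_of_false (fun h => absurd ((h0 _).1 h) (by simpa using ht.le))
          (fun h => absurd ((h0 _).1 h) hc.not_gt)
      · exact iff_of_true ((h1 _).2 (by simpa using ht)) ((h1 _).2 hc)
  choose ψ hψp hψ using hex
  refine ⟨ψ, hψp, fun x y hxy => ?_⟩
  have hψlt : SLt (Fin 2) (ψ x) (ψ y) := by
    rw [hlt]
    have h2 : (k x : ℝ) + 1 ≤ k y := by
      have : (k x : ℕ) < k y := hk hxy
      exact_mod_cast this
    exact (hψ x).2.trans_le (h2.trans (hψ y).1.le)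
  refine ⟨hψlt, fun s t hst hs ht _ => ?_⟩
  rw [h.sEdge_iff hT hψlt, h.sEdge_iff hT hst, hs, ht]

/-! ### The generic tournament -/

theorem IsGenericStar.isStrictTotalOrder {T : Type u} [Countable T]
    [(starLang (Fin 0)).Structure T] (h : IsGenericStar T) :
    IsStrictTotalOrder T (SLt (Fin 0)) := by
  -- The order axioms involve at most three points, so they can be checked in finitely generated
  -- substructures, which belong to the class.
  have key : ∀ s : Set T, s.Finite →
      IsStrictTotalOrder (Substructure.closure (starLang (Fin 0)) s) (SLt (Fin 0)) := by
    intro s hs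
    have h1 := age.fg_substructure (Substructure.fg_closure (L := starLang (Fin 0)) hs)
    rw [IsFraisseLimit.age h] at h1
    exact h1.2.2
  have hval : ∀ (s : Set T) (x y : Substructure.closure (starLang (Fin 0)) s),
      SLt (Fin 0) (x : T) (y : T) ↔ SLt (Fin 0) x y := fun s x y =>
    map_sLt (Substructure.subtype _) x y
  have hmem : ∀ (s : Set T) {x}, x ∈ s → x ∈ Substructure.closure (starLang (Fin 0)) s :=
    fun s x hx => Substructure.subset_closure hx
  refine { trichotomous := fun x y hxy hyx => ?_, irrefl := fun x hx => ?_,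
           trans := fun x y z hxy hyz => ?_ }
  · have := key {x, y} (Set.toFinite _)
    let x' : Substructure.closure (starLang (Fin 0)) {x, y} := ⟨x, hmem _ (by simp)⟩
    let y' : Substructure.closure (starLang (Fin 0)) {x, y} := ⟨y, hmem _ (by simp)⟩
    rcases trichotomous_of (SLt (Fin 0)) x' y' with h | h | h
    · exact (hxy ((hval _ x' y').2 h)).elim
    · exact congrArg Subtype.val h
    · exact (hyx ((hval _ y' x').2 h)).elim
  · have := key {x} (Set.toFinite _)
    let x' : Substructure.closure (starLang (Fin 0)) {x} := ⟨x, hmem _ (by simp)⟩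
    exact irrefl_of (SLt (Fin 0)) x' ((hval _ x' x').1 hx)
  · have := key {x, y, z} (Set.toFinite _)
    let x' : Substructure.closure (starLang (Fin 0)) {x, y, z} := ⟨x, hmem _ (by simp)⟩
    let y' : Substructure.closure (starLang (Fin 0)) {x, y, z} := ⟨y, hmem _ (by simp)⟩
    let z' : Substructure.closure (starLang (Fin 0)) {x, y, z} := ⟨z, hmem _ (by simp)⟩
    exact (hval _ x' z').2 (trans_of (SLt (Fin 0)) ((hval _ x' y').1 hxy) ((hval _ y' z').1 hyz))

/-- The ordered tournament on `V` in which the increasing pairs in `d` are edges, and the other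
pairs are oriented downwards. -/
@[reducible]
def orderedTournament {V : Type u} [LinearOrder V] (d : V → V → Prop) :
    (starLang (Fin 0)).Structure V where
  funMap := fun f _ => Empty.elim f
  RelMap := fun R => match R with
    | StarRel.edge => fun v => v 0 < v 1 ∧ d (v 0) (v 1) ∨ v 1 < v 0 ∧ ¬ d (v 1) (v 0)
    | StarRel.lt => fun v => v 0 < v 1
    | StarRel.pred i => i.elim0

/-- Of the Fraïssé limit only the age matters: `orderedTournament d` is a finite ordered tournament,
so it embeds in `T`. -/
theorem IsGenericStar.realizesOrders {T : Type u} [Countable T]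
    [(starLang (Fin 0)).Structure T] (h : IsGenericStar T) : RealizesOrders (Fin 0) T := by
  intro V _ _ a d
  let _ := orderedTournament d
  have hE : ∀ x y : V, SEdge (Fin 0) x y ↔ x < y ∧ d x y ∨ y < x ∧ ¬ d y x := fun _ _ => Iff.rfl
  have hVE : IsTournamentRel (T := V) (SEdge (Fin 0)) := by
    refine ⟨fun x => by simp [hE], fun x y hxy => ?_⟩
    unfold Xor
    rw [hE, hE]
    rcases lt_or_gt_of_ne hxy with h | h <;> simp [h, h.not_gt, em, em']
  have hV : (Bundled.of V : Bundled.{u} (starLang (Fin 0)).Structure) ∈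
      (starLang (Fin 0)).age T := by
    rw [IsFraisseLimit.age h]
    exact ⟨inferInstanceAs (Finite V), hVE,
      inferInstanceAs (IsStrictTotalOrder V (fun x y : V => x < y))⟩
  obtain ⟨-, ⟨(e : V ↪[starLang (Fin 0)] T)⟩⟩ := hV
  refine ⟨e, fun x i => i.elim0, fun x y hxy => ⟨(map_sLt e x y).2 hxy, fun s t _ _ _ hd => ?_⟩⟩
  rw [map_sEdge, hE, ← hd]
  simp [hxy, hxy.not_gt]

/-! ### The main theorem -/

theorem sEdge_iff_edge {κ : Type} {T : Type u} [digraphLang.Structure T]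
    [(starLang κ).Structure T] [(digraphToStar κ).IsExpansionOn T] (x y : T) :
    SEdge κ x y ↔ Edge x y :=
  iff_of_eq (LHom.IsExpansionOn.map_onRelation (ϕ := digraphToStar κ) DigraphRel.edge ![x, y])

theorem mainTheorem12 {T : Type u} [Countable T] [digraphLang.Structure T]
    (hT : IsTournamentRel (T := T) Edge) (hhom : digraphLang.IsUltrahomogeneous T)
    (k : TournamentKind) [(starLang (Fin k.numPred)).Structure T]
    [(digraphToStar (Fin k.numPred)).IsExpansionOn T]
    (hstar : IsStandardExpansion k T) (n : ℕ) :
    HasRamseyProperty (starLang (Fin k.numPred ⊕ Fin n))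
      ((starLang (Fin k.numPred ⊕ Fin n)).age (CopiesOf n T)) := by
  have hE : IsTournamentRel (T := T) (SEdge (Fin k.numPred)) := by
    simpa only [IsTournamentRel, sEdge_iff_edge] using hT
  rename_i S _
  cases k with
  | point =>
    obtain ⟨⟨e⟩, -, -, -⟩ := id hstar
    refine hasRamseyProperty_age_of_pred_ext _ fun x y hxy => Prod.ext ?_ (e.injective rfl)
    exact ((hxy (Sum.inr x.1)).1 rfl).symm
  | cycle =>
    obtain ⟨-, ⟨f, hf⟩, -⟩ := id hstar
    refine hasRamseyProperty_age_of_pred_ext _ fun x y hxy => Prod.ext ?_ (f.injective ?_)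
    · exact ((hxy (Sum.inr x.1)).1 rfl).symm
    · exact ((hf _ _).1 ((hxy (Sum.inl (f x.2))).1 ((hf _ _).2 rfl))).symm
  | rationals =>
    have : IsStrictTotalOrder T (SLt (Fin TournamentKind.rationals.numPred)) :=
      @IsRationalsStar.isStrictTotalOrder T S hstar
    exact CopiesOf.hasRamseyProperty_age hE (@IsRationalsStar.realizesOrders T S hstar) n
  | denseLocalOrder =>
    have : IsStrictTotalOrder T (SLt (Fin TournamentKind.denseLocalOrder.numPred)) :=
      @IsDenseLocalOrderStar.isStrictTotalOrder T S hE hstar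
    exact CopiesOf.hasRamseyProperty_age hE (@IsDenseLocalOrderStar.realizesOrders T S hE hstar) n
  | generic =>
    have : IsStrictTotalOrder T (SLt (Fin TournamentKind.generic.numPred)) :=
      @IsGenericStar.isStrictTotalOrder T _ S hstar
    exact CopiesOf.hasRamseyProperty_age hE (@IsGenericStar.realizesOrders T _ S hstar) n
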